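/- All groups are additively written abelian groups. A subgroup $H$ of a group $S$ is essential in $S$ if $H\cap K\neq 0$ for every nonzero subgroup $K\le S$. A group $G$ is called semi-generalized co-Bassian if, for every subgroup $H\le G$ and every injective homomorphism $\varphi\colon G\to G/H$, the image $\varphi(G)$ is an essential subgroup of some direct summand of $G/H$. The torsion-free rank of $G$ is the maximal cardinality of a $\mathbb{Z}$-linearly independent subset of $G$. A group is elementary if each of its elements has finite square-free order (equivalently, if it is a direct sum of cyclic groups of prime order, for possibly different primes). Let $G$ be a semi-generalized co-Bassian group of infinite torsion-free rank, and let $T$ be the torsion subgroup of $G$. Then $G/T$ is divisible, and $T\cong D\oplus E$ for some divisible group $D$ and some elementary group $E$. -/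

import Mathlib

/-- The subgroup `H` is essential in the subgroup `S` (both subgroups of the same abelian group `A`):
`H ≤ S`, and `H` meets every nonzero subgroup of `S` in a nonzero subgroup. -/
def IsEssentialIn {A : Type*} [AddCommGroup A] (H S : AddSubgroup A) : Prop :=
  H ≤ S ∧ ∀ K : AddSubgroup A, K ≤ S → K ≠ ⊥ → H ⊓ K ≠ ⊥

/-- The subgroup `S` is a direct summand of `A`: there is a subgroup `C` with `A = S ⊕ C`. -/
def IsDirectSummand {A : Type*} [AddCommGroup A] (S : AddSubgroup A) : Prop :=
  ∃ C : AddSubgroup A, IsCompl S C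

/-- `G` is semi-generalized co-Bassian: for every subgroup `H` of `G`, the image of any injective
homomorphism `φ : G → G / H` is essential in some direct summand of `G / H`. -/
def IsSemiGeneralizedCoBassian (G : Type*) [AddCommGroup G] : Prop :=
  ∀ (H : AddSubgroup G) (φ : G →+ G ⧸ H), Function.Injective φ →
    ∃ S : AddSubgroup (G ⧸ H), IsDirectSummand S ∧ IsEssentialIn φ.range S

/-- The abelian group `A` is divisible: `nA = A` for every nonzero integer `n`. -/
def IsDivisibleGroup (A : Type*) [AddCommGroup A] : Prop :=
  Nonempty (DivisibleBy A ℤ)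

/-- The abelian group `A` is elementary: every element has finite square-free order
(`addOrderOf x = 0`, i.e. infinite order, is excluded since `0` is not square-free).
Equivalently, `A` is a direct sum of cyclic groups of prime order, the primes being allowed to
vary. -/
def IsElementaryGroup (A : Type*) [AddCommGroup A] : Prop :=
  ∀ x : A, Squarefree (addOrderOf x)

/-- The abelian group `A` is isomorphic to `D ⊕ E` for some divisible group `D` and some elementary
group `E`. -/
def IsDPlusE.{u} (A : Type u) [AddCommGroup A] : Prop :=
  ∃ (D E : Type u) (_ : AddCommGroup D) (_ : AddCommGroup E),
    IsDivisibleGroup D ∧ IsElementaryGroup E ∧ Nonempty (A ≃+ D × E)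

universe u

/-! The free part of `G` has infinite rank, so a free subgroup `F` with `G / F` torsion maps onto
any `(ι →₀ ℚ) × P` with `P` countable divisible, `ι` indexing a basis of `F`. If `F ≤ L`, then `G`
therefore maps onto the product of such a divisible group with `G ⧸ L`. The same divisible factor
also receives a map `f` whose kernel is torsion, and this gives room to build injections `φ` from
`G` into the product that the co-Bassian condition forces to be essential in a summand `S` with
complement `C`.

First use (`exists_pow_zsmul_eq`): suppose `⟨y⟩` were a cyclic summand of order `p ^ (j + 1)`, `j ≥
1`. Let `φ` send `y` to its image in a divisible hull `P` of `⟨y⟩` together with `p ^ j • y` in `G ⧸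
L`. Essentiality makes `C` bounded, so `S` absorbs the divisible factor element `χ y`, hence also
the image of `p ^ j • y`. But `S` misses the image of `⟨y⟩` in `G ⧸ L`, a contradiction.
Consequently `p T_p` is divisible for every `p`, and splitting off the sum of these subgroups from
`T` leaves an elementary group.

Second use (`exists_eq_zsmul_add_torsion`): `T_p` now splits off, say `G = T_p ⊕ M`. Take `F` inside
`M ∩ pG` and `φ = (f, mk)`. Then `C` is `p`-divisible, while elements of `S` lying in `G ⧸ F` come
from `pG + T`. Together they give `G = pG + T` for every `p`, so `G/T` is divisible. -/

/-! ### Divisible groups. -/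

theorem isDivisibleGroup_iff {A : Type*} [AddCommGroup A] :
    IsDivisibleGroup A ↔ ∀ n : ℤ, n ≠ 0 → ∀ x : A, ∃ y, n • y = x := by
  constructor
  · rintro ⟨h⟩ n hn x
    exact ⟨DivisibleBy.div x n, DivisibleBy.div_cancel x hn⟩
  · intro h
    exact ⟨divisibleByOfSMulRightSurj A ℤ fun {n} hn x => h n hn x⟩

/-- Homomorphisms into a divisible group extend from subgroups. -/
theorem IsDivisibleGroup.exists_extension {A : Type*} [AddCommGroup A] (hA : IsDivisibleGroup A)
    {G : Type*} [AddCommGroup G] (N : AddSubgroup G) (g : N →+ A) :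
    ∃ h : G →+ A, ∀ x : N, h x = g x := by
  obtain ⟨_⟩ := hA
  obtain ⟨h, hh⟩ := (Module.Baer.of_divisible A).extension_property_addMonoidHom N.subtype
    Subtype.val_injective g
  exact ⟨h, fun x => DFunLike.congr_fun hh x⟩

theorem IsDivisibleGroup.of_surjective {A B : Type*} [AddCommGroup A] [AddCommGroup B]
    (hA : IsDivisibleGroup A) (f : A →+ B) (hf : Function.Surjective f) : IsDivisibleGroup B := by
  rw [isDivisibleGroup_iff] at hA ⊢
  intro n hn x
  obtain ⟨a, rfl⟩ := hf x
  obtain ⟨b, rfl⟩ := hA n hn a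
  exact ⟨f b, (map_zsmul f n b).symm⟩

theorem IsDivisibleGroup.prod {A B : Type*} [AddCommGroup A] [AddCommGroup B]
    (hA : IsDivisibleGroup A) (hB : IsDivisibleGroup B) : IsDivisibleGroup (A × B) := by
  rw [isDivisibleGroup_iff] at hA hB ⊢
  rintro n hn ⟨x, y⟩
  obtain ⟨a, rfl⟩ := hA n hn x
  obtain ⟨b, rfl⟩ := hB n hn y
  exact ⟨(a, b), rfl⟩

theorem isDivisibleGroup_rat : IsDivisibleGroup ℚ := by
  rw [isDivisibleGroup_iff]
  intro n hn x
  have : (n : ℚ) ≠ 0 := by exact_mod_cast hn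
  exact ⟨x / n, by rw [zsmul_eq_mul]; field_simp⟩

theorem isDivisibleGroup_finsupp_rat (ι : Type*) : IsDivisibleGroup (ι →₀ ℚ) := by
  rw [isDivisibleGroup_iff]
  intro n hn x
  have : (n : ℚ) ≠ 0 := by exact_mod_cast hn
  refine ⟨(n : ℚ)⁻¹ • x, ?_⟩
  rw [← Int.cast_smul_eq_zsmul ℚ, smul_smul, mul_inv_cancel₀ this, one_smul]

/-! ### Essential subgroups and the co-Bassian condition. -/

theorem IsEssentialIn.exists_zsmul_mem {A : Type*} [AddCommGroup A] {H S : AddSubgroup A}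
    (h : IsEssentialIn H S) {x : A} (hx : x ∈ S) (hx0 : x ≠ 0) :
    ∃ n : ℤ, n • x ∈ H ∧ n • x ≠ 0 := by
  have hK := h.2 (AddSubgroup.zmultiples x) (by simpa using hx) (by simpa using hx0)
  obtain ⟨⟨y, hy⟩, hy0⟩ := AddSubgroup.ne_bot_iff_exists_ne_zero.1 hK
  obtain ⟨n, rfl⟩ := AddSubgroup.mem_zmultiples_iff.1 (AddSubgroup.mem_inf.1 hy).2
  exact ⟨n, (AddSubgroup.mem_inf.1 hy).1, fun h0 => hy0 (Subtype.ext h0)⟩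

/-- The defining property of semi-generalized co-Bassian groups, for arbitrary homomorphic images
in place of quotients. -/
theorem IsSemiGeneralizedCoBassian.exists_summand {G : Type*} [AddCommGroup G]
    (hG : IsSemiGeneralizedCoBassian G) {A : Type*} [AddCommGroup A] (q : G →+ A)
    (hq : Function.Surjective q) (φ : G →+ A) (hφ : Function.Injective φ) :
    ∃ S C : AddSubgroup A, IsCompl S C ∧ φ.range ≤ S ∧
      ∀ x ∈ S, x ≠ 0 → ∃ n : ℤ, n • x ∈ φ.range ∧ n • x ≠ 0 := by
  let e : G ⧸ q.ker ≃+ A := QuotientAddGroup.quotientKerEquivOfSurjective q hq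
  obtain ⟨S, ⟨C, hSC⟩, hS⟩ := hG q.ker (e.symm.toAddMonoidHom.comp φ)
    (e.symm.injective.comp hφ)
  refine ⟨e.mapAddSubgroup S, e.mapAddSubgroup C, hSC.map e.mapAddSubgroup, ?_, ?_⟩
  · rintro _ ⟨g, rfl⟩
    exact ⟨e.symm (φ g), hS.1 ⟨g, rfl⟩, e.apply_symm_apply _⟩
  · rintro _ ⟨s, hs, rfl⟩ hs0
    obtain ⟨n, ⟨g, hg⟩, hn0⟩ := hS.exists_zsmul_mem hs (by rintro rfl; simp at hs0)
    have hg' : φ g = n • e s := by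
      rw [← map_zsmul, ← hg]
      exact (e.apply_symm_apply _).symm
    refine ⟨n, ⟨g, hg'⟩, ?_⟩
    change n • e s ≠ 0
    rw [← map_zsmul]
    exact e.map_ne_zero_iff.2 hn0

/-- Among the subgroups of `N` containing `B` and meeting `K` trivially there is a maximal one. -/
theorem AddSubgroup.exists_maximal_disjoint {G : Type*} [AddCommGroup G] (B N K : AddSubgroup G)
    (hBN : B ≤ N) (hB : ∀ x ∈ B, x ∈ K → x = 0) :
    ∃ M : AddSubgroup G, B ≤ M ∧ M ≤ N ∧ (∀ x ∈ M, x ∈ K → x = 0) ∧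
      ∀ g ∈ N, g ∉ M → ∃ n : ℤ, ∃ m ∈ M, m + n • g ∈ K ∧ m + n • g ≠ 0 := by
  obtain ⟨M, hBM, hM⟩ := zorn_le_nonempty₀
    {M : AddSubgroup G | M ≤ N ∧ ∀ x ∈ M, x ∈ K → x = 0} (by
      intro c hc hchain y hy
      refine ⟨sSup c, ⟨sSup_le fun z hz => (hc hz).1, fun x hx hxK => ?_⟩,
        fun z hz => le_sSup hz⟩
      obtain ⟨z, hz, hxz⟩ := (AddSubgroup.mem_sSup_of_directedOn ⟨y, hy⟩ hchain.directedOn).1 hx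
      exact (hc hz).2 x hxz hxK) B ⟨hBN, hB⟩
  refine ⟨M, hBM, hM.prop.1, hM.prop.2, fun g hg hgM => ?_⟩
  by_contra! hcon
  refine hgM (hM.le_of_ge (y := M ⊔ AddSubgroup.zmultiples g)
    ⟨sup_le hM.prop.1 (by simpa using hg), fun x hx hxK => ?_⟩ le_sup_left
    (AddSubgroup.mem_sup_right (AddSubgroup.mem_zmultiples g)))
  obtain ⟨m, hm, _, ⟨n, rfl⟩, rfl⟩ := AddSubgroup.mem_sup.1 hx
  exact hcon n m hm hxK

/-! ### Free subgroups with torsion quotient. -/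

/-- A maximal independent family in `N` spans up to torsion. Were it finite, its span, and hence
`G`, would have finite rank. -/
theorem exists_infinite_linearIndepOn {G : Type u} [AddCommGroup G]
    (hrank : Cardinal.aleph0 ≤ Module.rank ℤ G) (N : AddSubgroup G)
    (hN : ∀ g : G, ∃ n : ℤ, n ≠ 0 ∧ n • g ∈ N) :
    ∃ s : Set N, Infinite s ∧ LinearIndependent ℤ (fun i : s => ((i : N) : G)) ∧
      ∀ g : G, ∃ n : ℤ, n ≠ 0 ∧
        n • g ∈ Submodule.span ℤ (Set.range fun i : s => ((i : N) : G)) := by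
  obtain ⟨s, hs, hmax⟩ := exists_maximal_linearIndepOn ℤ (fun x : N => (x : G))
  have hspan : ∀ g : G, ∃ n : ℤ, n ≠ 0 ∧
      n • g ∈ Submodule.span ℤ (Set.range fun i : s => ((i : N) : G)) := by
    intro g
    rw [← Set.image_eq_range]
    obtain ⟨n, hn, hng⟩ := hN g
    by_cases h : (⟨n • g, hng⟩ : N) ∈ s
    · exact ⟨n, hn, Submodule.subset_span ⟨_, h, rfl⟩⟩
    · obtain ⟨a, ha, hag⟩ := hmax _ h
      exact ⟨a * n, mul_ne_zero ha hn, by rwa [mul_smul]⟩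
  refine ⟨s, ?_, hs, hspan⟩
  by_contra hfin
  have : Finite s := not_infinite_iff_finite.1 hfin
  set F := Submodule.span ℤ (Set.range fun i : s => ((i : N) : G))
  have hF : Module.Finite ℤ F := Module.Finite.span_of_finite ℤ (Set.finite_range _)
  have h1 : Module.rank ℤ (G ⧸ F) = 0 := by
    rw [rank_eq_zero_iff]
    intro x
    obtain ⟨g, rfl⟩ := Submodule.Quotient.mk_surjective F x
    obtain ⟨n, hn, hng⟩ := hspan g
    exact ⟨n, hn, by rwa [← Submodule.Quotient.mk_smul, Submodule.Quotient.mk_eq_zero]⟩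
  have h2 := rank_quotient_add_rank_of_isDomain F
  rw [h1, zero_add] at h2
  exact absurd (h2 ▸ hrank) (not_le.2 (Module.rank_lt_aleph0 ℤ F))

/-- The target has cardinality at most that of `ι`. The infinite rank makes this available for a
basis of `F`. -/
theorem exists_surjective_finsupp_rat_prod (ι : Type u) [Infinite ι] (P : Type) [Countable P]
    [Nonempty P] : ∃ f : ι → (ι →₀ ℚ) × P, Function.Surjective f := by
  have h : Cardinal.mk ((ι →₀ ℚ) × P) ≤ Cardinal.mk ι := by
    have hι := Cardinal.aleph0_le_mk ι
    rw [Cardinal.mk_prod, Cardinal.lift_uzero, Cardinal.mk_finsupp_lift_of_infinite]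
    refine Cardinal.mul_le_of_le hι ?_ ?_
    · simp
    · exact (Cardinal.lift_le_aleph0.2 (Cardinal.mk_le_aleph0)).trans hι
  obtain ⟨g⟩ := h
  exact ⟨Function.invFun g, Function.invFun_surjective g.injective⟩

/-- In a group of infinite torsion-free rank, every subgroup `N` with torsion quotient contains
a free subgroup `F` with torsion quotient that has a divisible hull `ι →₀ ℚ` and also maps onto
`(ι →₀ ℚ) × P`; both homomorphisms extend to the whole group. -/
theorem exists_free_subgroup {G : Type u} [AddCommGroup G]
    (hrank : Cardinal.aleph0 ≤ Module.rank ℤ G) (N : AddSubgroup G)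
    (hN : ∀ g : G, ∃ n : ℤ, n ≠ 0 ∧ n • g ∈ N) (P : Type) [AddCommGroup P] [Countable P]
    (hP : IsDivisibleGroup P) :
    ∃ (ι : Type u) (F : AddSubgroup G) (f : G →+ (ι →₀ ℚ)) (w : G →+ (ι →₀ ℚ) × P),
      F ≤ N ∧ (∀ g : G, ∃ n : ℤ, n ≠ 0 ∧ n • g ∈ F) ∧ (∀ x ∈ F, f x = 0 → x = 0) ∧
      (∀ b : ι →₀ ℚ, ∃ n : ℤ, n ≠ 0 ∧ ∃ x ∈ F, f x = n • b) ∧ ∀ z, ∃ x ∈ F, w x = z := by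
  obtain ⟨s, hinf, hs, hspan⟩ := exists_infinite_linearIndepOn hrank N hN
  set v : s → G := fun i => ((i : N) : G) with hv
  let b := Module.Basis.span hs
  let F : AddSubgroup G := (Submodule.span ℤ (Set.range v)).toAddSubgroup
  have hbF : ∀ i, ((b i : Submodule.span ℤ (Set.range v)) : G) = v i :=
    fun i => congrArg Subtype.val (Module.Basis.span_apply hs i)
  let f₀ : Submodule.span ℤ (Set.range v) →ₗ[ℤ] (s →₀ ℚ) :=
    (Finsupp.mapRange.linearMap (Algebra.linearMap ℤ ℚ)).comp b.repr.toLinearMap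
  -- Every element of the target is already the image of a basis vector, so `w₀` is onto.
  obtain ⟨r, hr⟩ := exists_surjective_finsupp_rat_prod s P
  let w₀ : Submodule.span ℤ (Set.range v) →ₗ[ℤ] (s →₀ ℚ) × P := b.constr ℤ r
  obtain ⟨f, hf⟩ := (isDivisibleGroup_finsupp_rat s).exists_extension F f₀.toAddMonoidHom
  obtain ⟨w, hw⟩ := ((isDivisibleGroup_finsupp_rat s).prod hP).exists_extension F
    w₀.toAddMonoidHom
  refine ⟨s, F, f, w, ?_, hspan, ?_, ?_, ?_⟩
  · change Submodule.span ℤ (Set.range v) ≤ N.toIntSubmodule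
    rw [Submodule.span_le]
    rintro _ ⟨i, rfl⟩
    exact i.1.2
  · intro x hx hfx
    have h0 : f₀ ⟨x, hx⟩ = 0 := (hf ⟨x, hx⟩).symm.trans hfx
    have : Function.Injective f₀ := by
      have h : Function.Injective (Finsupp.mapRange.linearMap (α := s) (Algebra.linearMap ℤ ℚ)) :=
        Finsupp.mapRange_injective (Algebra.linearMap ℤ ℚ) (map_zero _) Int.cast_injective
      exact h.comp b.repr.injective
    exact congrArg Subtype.val ((map_eq_zero_iff f₀ this).1 h0)
  · intro c
    induction c using Finsupp.induction_linear with
    | zero => exact ⟨1, one_ne_zero, 0, F.zero_mem, by simp⟩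
    | add c d hc hd =>
      obtain ⟨n, hn, x, hx, hxc⟩ := hc
      obtain ⟨m, hm, y, hy, hyd⟩ := hd
      refine ⟨m * n, mul_ne_zero hm hn, m • x + n • y,
        F.add_mem (F.zsmul_mem hx _) (F.zsmul_mem hy _), ?_⟩
      rw [map_add, map_zsmul, map_zsmul, hxc, hyd]
      module
    | single i q =>
      refine ⟨q.den, by exact_mod_cast q.den_nz, q.num • (b i : G), F.zsmul_mem (b i).2 _, ?_⟩
      have : f (b i) = f₀ (b i) := hf (b i)
      rw [map_zsmul, this]
      simp only [f₀, LinearMap.comp_apply, LinearEquiv.coe_coe, Module.Basis.repr_self,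
        Finsupp.mapRange.linearMap_apply, Finsupp.mapRange_single, Finsupp.smul_single]
      congr 1
      simp [mul_comm, Rat.mul_den_eq_num]
  · intro z
    obtain ⟨i, rfl⟩ := hr z
    exact ⟨b i, (b i).2, (hw (b i)).trans (b.constr_basis ℤ r i)⟩

/-! ### Torsion elements and essentiality in products. -/

theorem mem_torsion_iff_zsmul {G : Type*} [AddCommGroup G] {x : G} :
    x ∈ AddCommGroup.torsion G ↔ ∃ n : ℤ, n ≠ 0 ∧ n • x = 0 := by
  rw [AddCommGroup.mem_torsion, isOfFinAddOrder_iff_zsmul_eq_zero]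

theorem map_eq_zero_of_mem_torsion {G : Type*} [AddCommGroup G] {ι : Type*} (f : G →+ (ι →₀ ℚ))
    {x : G} (hx : x ∈ AddCommGroup.torsion G) : f x = 0 := by
  obtain ⟨n, hn, hx⟩ := mem_torsion_iff_zsmul.1 hx
  have h : n • f x = 0 := by rw [← map_zsmul, hx, map_zero]
  rw [← Int.cast_smul_eq_zsmul ℚ] at h
  exact (smul_eq_zero.1 h).resolve_left (by exact_mod_cast hn)

/-- If `f` is injective on a subgroup with torsion quotient, the kernel of `f` is torsion. -/
theorem mem_torsion_of_map_eq_zero {G A : Type*} [AddCommGroup G] [AddCommGroup A]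
    {F : AddSubgroup G} {f : G →+ A} (hF : ∀ g : G, ∃ n : ℤ, n ≠ 0 ∧ n • g ∈ F)
    (hf : ∀ x ∈ F, f x = 0 → x = 0) {x : G} (hx : f x = 0) : x ∈ AddCommGroup.torsion G := by
  obtain ⟨n, hn, hnx⟩ := hF x
  exact mem_torsion_iff_zsmul.2 ⟨n, hn, hf _ hnx (by rw [map_zsmul, hx, smul_zero])⟩

/-- Every nonzero element of `Y` has a nonzero multiple in `R`. -/
def MeetsMultiples {A : Type*} [AddCommGroup A] (R Y : AddSubgroup A) : Prop :=
  ∀ x ∈ Y, x ≠ 0 → ∃ n : ℤ, n • x ∈ R ∧ n • x ≠ 0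

/-- Bring one coordinate into its subgroup first. If the other is still nonzero, multiply again to
bring it in without killing it; the first stays inside. -/
theorem MeetsMultiples.prod {A B : Type*} [AddCommGroup A] [AddCommGroup B]
    {R Y : AddSubgroup A} {R' Y' : AddSubgroup B} (h : MeetsMultiples R Y)
    (h' : MeetsMultiples R' Y') : MeetsMultiples (R.prod R') (Y.prod Y') := by
  rintro ⟨a, b⟩ ⟨ha, hb⟩ hab
  by_cases ha0 : a = 0
  · subst ha0
    obtain ⟨n, hn, hn0⟩ := h' b hb (by rintro rfl; exact hab rfl)
    exact ⟨n, ⟨by simp, hn⟩, fun h0 => hn0 (congrArg Prod.snd h0)⟩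
  obtain ⟨n, hn, hn0⟩ := h a ha ha0
  by_cases hb0 : n • b = 0
  · exact ⟨n, ⟨hn, by simp [hb0]⟩, fun h0 => hn0 (congrArg Prod.fst h0)⟩
  obtain ⟨m, hm, hm0⟩ := h' _ (Y'.zsmul_mem hb n) hb0
  refine ⟨m * n, ⟨?_, ?_⟩, fun h0 => hm0 ?_⟩
  · change (m * n) • a ∈ R
    rw [mul_smul]
    exact R.zsmul_mem hn m
  · change (m * n) • b ∈ R'
    rwa [mul_smul]
  · rw [← mul_smul]
    exact congrArg Prod.snd h0

/-! ### Characters and cyclic direct summands. -/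

/-- The `p ^ (j + 1)`-torsion of `ℚ/ℤ` is cyclic, and any element of exact order `p ^ (j + 1)`
generates it: the numerator `m` of `c` is invertible modulo `p ^ (j + 1)`. -/
theorem mem_zmultiples_of_prime_pow_zsmul_eq_zero {p j : ℕ} (hp : p.Prime)
    {c z : AddCircle (1 : ℚ)} (hc : ((p : ℤ) ^ (j + 1)) • c = 0) (hc' : ((p : ℤ) ^ j) • c ≠ 0)
    (hz : ((p : ℤ) ^ (j + 1)) • z = 0) : ∃ n : ℤ, z = n • c := by
  obtain ⟨q, rfl⟩ := QuotientAddGroup.mk_surjective c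
  obtain ⟨r, rfl⟩ := QuotientAddGroup.mk_surjective z
  have hpQ : (p : ℚ) ≠ 0 := by exact_mod_cast hp.ne_zero
  have hpj : ((p : ℚ) ^ (j + 1)) ≠ 0 := pow_ne_zero _ hpQ
  have key : ∀ (n : ℤ) (x : ℚ), n • (x : AddCircle (1 : ℚ)) = 0 ↔ ∃ m : ℤ, (m : ℚ) = n * x := by
    intro n x
    rw [← AddCircle.coe_zsmul, AddCircle.coe_eq_zero_iff]
    simp
  obtain ⟨m, hm⟩ := (key _ _).1 hc
  obtain ⟨l, hl⟩ := (key _ _).1 hz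
  push_cast at hm hl
  have hcop : IsCoprime m ((p : ℤ) ^ (j + 1)) := by
    refine IsCoprime.pow_right ?_
    rw [isCoprime_comm]
    refine (Nat.prime_iff_prime_int.1 hp).coprime_iff_not_dvd.2 ?_
    rintro ⟨a, rfl⟩
    refine hc' ((key _ _).2 ⟨a, ?_⟩)
    push_cast at hm ⊢
    apply mul_left_cancel₀ hpQ
    rw [hm]
    ring
  obtain ⟨a, b, hab⟩ := hcop
  refine ⟨l * a, ?_⟩
  rw [← sub_eq_zero]
  change ((r : AddCircle (1 : ℚ)) - (l * a) • (q : AddCircle (1 : ℚ))) = 0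
  rw [← AddCircle.coe_zsmul, ← AddCircle.coe_sub, AddCircle.coe_eq_zero_iff]
  refine ⟨l * b, ?_⟩
  have hab' : (a : ℚ) * m + b * (p : ℚ) ^ (j + 1) = 1 := by exact_mod_cast hab
  simp only [zsmul_eq_mul]
  push_cast
  apply mul_left_cancel₀ hpj
  linear_combination hl - (l : ℚ) * a * hm + (l : ℚ) * hab'

/-- Characters of `G / p ^ (j + 1) G` separate points, and `p ^ j • y` is nonzero there. -/
theorem exists_character {G : Type u} [AddCommGroup G] {p j : ℕ} {y : G}
    (hy' : ∀ g : G, ((p : ℤ) ^ (j + 1)) • g ≠ ((p : ℤ) ^ j) • y) :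
    ∃ χ : G →+ AddCircle (1 : ℚ), (∀ g, ((p : ℤ) ^ (j + 1)) • χ g = 0) ∧
      ((p : ℤ) ^ j) • χ y ≠ 0 := by
  let N : AddSubgroup G := (zsmulAddGroupHom ((p : ℤ) ^ (j + 1)) : G →+ G).range
  have hne : (((p : ℤ) ^ j • y : G) : G ⧸ N) ≠ 0 := by
    rw [Ne, QuotientAddGroup.eq_zero_iff]
    rintro ⟨g, hg⟩
    exact hy' g hg
  obtain ⟨c, hc⟩ := CharacterModule.exists_character_apply_ne_zero_of_ne_zero hne
  refine ⟨AddMonoidHom.comp c (QuotientAddGroup.mk' N), fun g => ?_, ?_⟩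
  · rw [← map_zsmul]
    have : QuotientAddGroup.mk' N ((p : ℤ) ^ (j + 1) • g) = 0 :=
      (QuotientAddGroup.eq_zero_iff _).2 ⟨g, rfl⟩
    exact (congrArg c this).trans (map_zero c)
  · rw [← map_zsmul]
    exact hc

/-- Some nonzero multiple of a nonzero element of `p`-power order has order `p`. -/
theorem exists_pow_zsmul_ne_zero {G : Type*} [AddCommGroup G] {p k : ℕ} {x : G} (hx : x ≠ 0)
    (hk : ((p : ℤ) ^ k) • x = 0) : ∃ i, ((p : ℤ) ^ i) • x ≠ 0 ∧ ((p : ℤ) ^ (i + 1)) • x = 0 := by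
  induction k with
  | zero => exact absurd (by simpa using hk) hx
  | succ k ih =>
    by_cases h : ((p : ℤ) ^ k) • x = 0
    · exact ih h
    · exact ⟨k, h, hk⟩

/-- A retraction onto the subgroup generated by `y`, obtained from a homomorphism that is injective
on that subgroup and maps it onto the whole range. -/
theorem exists_retraction_zmultiples {G A : Type*} [AddCommGroup G] [AddCommGroup A] (χ : G →+ A)
    (y : G) (hχ : ∀ g, ∃ n : ℤ, χ g = n • χ y) (hy : ∀ n : ℤ, n • χ y = 0 → n • y = 0) :
    ∃ r : G →+ G, (∀ n : ℤ, r (n • y) = n • y) ∧ ∀ g, χ g = 0 → r g = 0 := by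
  choose n hn using hχ
  have huniq : ∀ a b : ℤ, a • χ y = b • χ y → a • y = b • y := fun a b hab => by
    rw [← sub_eq_zero, ← sub_smul] at hab ⊢
    exact hy _ hab
  refine ⟨AddMonoidHom.mk' (fun g => n g • y) fun g h => ?_, fun m => ?_, fun g hg => ?_⟩
  · rw [← add_smul]
    apply huniq
    rw [add_smul, ← hn, ← hn, ← hn, map_add]
  · exact huniq _ _ (by rw [← hn, map_zsmul])
  · exact hy _ (by rw [← hn, hg])

/-- A semi-generalized co-Bassian group of infinite torsion-free rank has no cyclic direct summand of
order `p ^ (j + 1)` with `j ≥ 1`, stated in terms of heights. -/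
theorem IsSemiGeneralizedCoBassian.exists_pow_zsmul_eq {G : Type u} [AddCommGroup G]
    (hG : IsSemiGeneralizedCoBassian G) (hrank : Cardinal.aleph0 ≤ Module.rank ℤ G)
    {p j : ℕ} (hp : p.Prime) (hj : 1 ≤ j) {y : G} (hy : ((p : ℤ) ^ (j + 1)) • y = 0) :
    ∃ g : G, ((p : ℤ) ^ (j + 1)) • g = ((p : ℤ) ^ j) • y := by
  by_contra! hy'
  have hpZ : (p : ℤ) ≠ 0 := by exact_mod_cast hp.ne_zero
  have hpow : ∀ i : ℕ, (p : ℤ) ^ i ≠ 0 := fun i => pow_ne_zero i hpZ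
  obtain ⟨χ₀, hχ, hχy⟩ := exists_character hy'
  have hcyc : ∀ g, ∃ n : ℤ, χ₀ g = n • χ₀ y := fun g =>
    mem_zmultiples_of_prime_pow_zsmul_eq_zero hp (hχ y) hχy (hχ g)
  have hinj : ∀ n : ℤ, n • χ₀ y = 0 → n • y = 0 := by
    intro n hn
    have : ((p : ℤ) ^ (j + 1)) ∣ n := by
      have h1 : addOrderOf (χ₀ y) = p ^ (j + 1) := by
        have := Fact.mk hp
        refine addOrderOf_eq_prime_pow ?_ ?_
        · exact_mod_cast hχy
        · exact_mod_cast hχ y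
      have h2 := addOrderOf_dvd_iff_zsmul_eq_zero.2 hn
      rw [h1] at h2
      exact_mod_cast h2
    obtain ⟨a, rfl⟩ := this
    rw [mul_comm, mul_smul, hy, smul_zero]
  obtain ⟨r, hry, hr0⟩ := exists_retraction_zmultiples χ₀ y hcyc hinj
  -- A countable divisible group in which the image of `y` generates an essential subgroup.
  obtain ⟨K, -, -, hK, hKmax⟩ := AddSubgroup.exists_maximal_disjoint (⊥ : AddSubgroup _) ⊤
    (AddSubgroup.zmultiples (χ₀ y)) bot_le (fun x hx _ => hx)
  let P := AddCircle (1 : ℚ) ⧸ K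
  let πP : AddCircle (1 : ℚ) →+ P := QuotientAddGroup.mk' K
  have hπP : Function.Surjective πP := QuotientAddGroup.mk'_surjective K
  have hπ0 : ∀ z, πP z = 0 ↔ z ∈ K := fun z => QuotientAddGroup.eq_zero_iff z
  have hP : IsDivisibleGroup P := isDivisibleGroup_rat.of_surjective
    (πP.comp (QuotientAddGroup.mk' (AddSubgroup.zmultiples (1 : ℚ))))
    (hπP.comp (QuotientAddGroup.mk'_surjective _))
  have : Countable P :=
    (hπP.comp (QuotientAddGroup.mk'_surjective (AddSubgroup.zmultiples (1 : ℚ)))).countable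
  let χ : G →+ P := πP.comp χ₀
  have hχ0 : ∀ g, χ g = 0 → χ₀ g = 0 := fun g hg => by
    obtain ⟨n, hn⟩ := hcyc g
    exact hK _ ((hπ0 _).1 hg) ⟨n, hn.symm⟩
  have hχχ : ∀ g, χ₀ g = 0 → χ g = 0 := fun g hg => by
    change πP (χ₀ g) = 0
    rw [hg, map_zero]
  let N : AddSubgroup G := χ₀.ker
  obtain ⟨ι, F, f, w, hFN, hF, hfF, hfX, hw⟩ := exists_free_subgroup hrank N
    (fun g => ⟨(p : ℤ) ^ (j + 1), hpow _, by
      rw [AddMonoidHom.mem_ker, map_zsmul, hχ]⟩) P hP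
  let T := AddCommGroup.torsion G
  have hfT : ∀ x ∈ T, f x = 0 := fun x hx => map_eq_zero_of_mem_torsion f hx
  have hTf : ∀ x, f x = 0 → x ∈ T := fun x hx => mem_torsion_of_map_eq_zero hF hfF hx
  -- Maximality makes the image of `T ⊓ N` essential in `N / L`; disjointness from `T` keeps torsion
  -- elements visible in `G ⧸ L`.
  obtain ⟨L, hFL, hLN, hLT, hLmax⟩ := AddSubgroup.exists_maximal_disjoint F N T hFN
    (fun x hx hxT => hfF x hx (hfT x hxT))
  have hyT : ∀ n : ℤ, n • y ∈ T := fun n => T.zsmul_mem (mem_torsion_iff_zsmul.2 ⟨_, hpow _, hy⟩) n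
  -- The identity on `ker χ₀` and multiplication by `p ^ j` on the summand `⟨y⟩`.
  let θ : G →+ G := AddMonoidHom.id G - r + ((p : ℤ) ^ j) • r
  have hθ : ∀ g, θ g = g - r g + ((p : ℤ) ^ j) • r g := fun g => rfl
  have hθN : ∀ g, χ₀ g = 0 → θ g = g := fun g hg => by rw [hθ, hr0 g hg]; simp
  have hθy : ∀ n : ℤ, θ (n • y) = ((p : ℤ) ^ j) • n • y := fun n => by rw [hθ, hry]; simp
  let mk : G →+ G ⧸ L := QuotientAddGroup.mk' L
  have hmk : ∀ g, mk g = 0 ↔ g ∈ L := fun g => QuotientAddGroup.eq_zero_iff g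
  let q : G →+ ((ι →₀ ℚ) × P) × (G ⧸ L) := w.prod mk
  let φ : G →+ ((ι →₀ ℚ) × P) × (G ⧸ L) := (f.prod χ).prod (mk.comp θ)
  have hφ : ∀ g, φ g = ((f g, χ g), mk (θ g)) := fun g => rfl
  have hq : Function.Surjective q := by
    rintro ⟨x, gL⟩
    obtain ⟨g, rfl⟩ := QuotientAddGroup.mk'_surjective L gL
    obtain ⟨l, hl, hlx⟩ := hw (x - w g)
    refine ⟨g + l, Prod.ext ?_ ?_⟩
    · change w (g + l) = x
      rw [map_add, hlx, add_sub_cancel]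
    · change mk (g + l) = mk g
      rw [map_add, (hmk l).2 (hFL hl), add_zero]
  have hφinj : Function.Injective φ := by
    rw [injective_iff_map_eq_zero]
    intro g hg
    have h1 : f g = 0 := congrArg (fun z => z.1.1) hg
    have h2 : χ g = 0 := congrArg (fun z => z.1.2) hg
    have h3 : mk (θ g) = 0 := congrArg (fun z => z.2) hg
    rw [hθN g (hχ0 g h2), hmk] at h3
    exact hLT g h3 (hTf g h1)
  obtain ⟨S, C, hSC, hφS, hess⟩ := hG.exists_summand q hq φ hφinj
  -- The complement `C` meets the kernel of the projection to `P` via `χ₀` trivially.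
  let V : AddSubgroup G := AddSubgroup.zmultiples y ⊓ (zsmulAddGroupHom (p : ℤ) : G →+ G).ker
  have hmeet : MeetsMultiples (((F.map f).prod (V.map χ)).prod ((T ⊓ N).map mk))
      (((⊤ : AddSubgroup (ι →₀ ℚ)).prod (⊤ : AddSubgroup P)).prod (N.map mk)) := by
    refine MeetsMultiples.prod (MeetsMultiples.prod ?_ ?_) ?_
    · intro b _ hb
      obtain ⟨n, hn, x, hx, hxb⟩ := hfX b
      refine ⟨n, ⟨x, hx, hxb⟩, ?_⟩
      rw [← Int.cast_smul_eq_zsmul ℚ]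
      exact smul_ne_zero (by exact_mod_cast hn) hb
    · intro b _ hb
      obtain ⟨z, rfl⟩ := hπP b
      obtain ⟨n, m, hm, ⟨k, hk⟩, hmn⟩ := hKmax z trivial
        (fun hz => hb ((hπ0 z).2 hz))
      have hk' : n • πP z = χ (k • y) := by
        change _ = πP (χ₀ (k • y))
        rw [map_zsmul χ₀]
        change _ = πP ((fun i : ℤ => i • χ₀ y) k)
        rw [hk, map_add, map_zsmul, (hπ0 m).2 hm, zero_add]
      have hky : k • y ≠ 0 := by
        intro h0
        apply hmn
        rw [← hk]
        change k • χ₀ y = 0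
        rw [← map_zsmul, h0, map_zero]
      obtain ⟨i, hi, hi'⟩ := exists_pow_zsmul_ne_zero (p := p) (k := j + 1) hky
        (by rw [smul_comm, hy, smul_zero])
      have hi2 : ((p : ℤ) ^ i * n) • πP z = χ ((p : ℤ) ^ i • k • y) := by
        rw [mul_smul, hk', ← map_zsmul χ]
      refine ⟨(p : ℤ) ^ i * n, ?_, ?_⟩
      · rw [hi2]
        refine ⟨_, ⟨⟨(p : ℤ) ^ i * k, mul_smul _ _ _⟩, ?_⟩, rfl⟩
        change (p : ℤ) • (p : ℤ) ^ i • k • y = 0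
        rw [← mul_smul, ← pow_succ', hi']
      · rw [hi2]
        intro h0
        have h1 := hχ0 _ h0
        rw [← mul_smul, map_zsmul] at h1
        exact hi (by rw [← mul_smul]; exact hinj _ h1)
    · rintro _ ⟨g, hg, rfl⟩ hg0
      obtain ⟨n, m, hm, ht, ht0⟩ := hLmax g hg (fun h => hg0 ((hmk g).2 h))
      have : n • mk g = mk (m + n • g) := by rw [map_add, (hmk m).2 hm, zero_add, map_zsmul]
      refine ⟨n, ?_, ?_⟩
      · rw [this]
        exact ⟨_, ⟨ht, N.add_mem (hLN hm) (N.zsmul_mem hg n)⟩, rfl⟩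
      · rw [this, Ne, hmk]
        exact fun h => ht0 (hLT _ h ht)
  -- Since `j ≥ 1`, `θ` kills the elements of `⟨y⟩` killed by `p`, so their images under `χ` appear
  -- in `φ.range` with zero third coordinate.
  have hrange : (((F.map f).prod (V.map χ)).prod ((T ⊓ N).map mk)) ≤ φ.range := by
    rintro ⟨⟨_, _⟩, _⟩ ⟨⟨⟨x, hx, rfl⟩, ⟨_, ⟨⟨n, rfl⟩, hz⟩, rfl⟩⟩, ⟨t, ⟨htT, htN⟩, rfl⟩⟩
    have hz' : (p : ℤ) • n • y = 0 := hz
    refine ⟨x + n • y + t, ?_⟩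
    rw [hφ]
    simp only [map_add]
    rw [hfT _ (hyT n), hfT t htT, hχχ x (hFN hx), hχχ t htN, hθN x (hFN hx), hθN t htN, hθy,
      (hmk x).2 (hFL hx)]
    have : (p : ℤ) ^ j • n • y = 0 := by
      obtain ⟨i, rfl⟩ := Nat.exists_eq_add_of_le' hj
      rw [pow_succ, mul_smul, hz', smul_zero]
    rw [this, map_zero]
    simp
  have hC : ∀ b g, (b, mk g) ∈ C → χ₀ g = 0 → (b, mk g) = (0 : ((ι →₀ ℚ) × P) × (G ⧸ L)) := by
    intro b g hc hg
    by_contra h0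
    obtain ⟨n, hn, hn0⟩ := hmeet (b, mk g) ⟨⟨trivial, trivial⟩, ⟨g, hg, rfl⟩⟩ h0
    exact hn0 (AddSubgroup.disjoint_def.1 hSC.disjoint (hφS (hrange hn)) (C.zsmul_mem hc n))
  -- Multiplying by `p ^ (j + 1)` moves the third coordinate into the image of `ker χ₀`, where `C`
  -- has only zero.
  have hC' : ∀ c ∈ C, ((p : ℤ) ^ (j + 1)) • c = 0 := by
    rintro ⟨b, gL⟩ hc
    obtain ⟨g, rfl⟩ := QuotientAddGroup.mk'_surjective L gL
    have h := C.zsmul_mem hc ((p : ℤ) ^ (j + 1))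
    have e : ((p : ℤ) ^ (j + 1)) • ((b, mk g) : ((ι →₀ ℚ) × P) × (G ⧸ L)) =
        (((p : ℤ) ^ (j + 1)) • b, mk (((p : ℤ) ^ (j + 1)) • g)) := by rw [map_zsmul]; rfl
    change ((p : ℤ) ^ (j + 1)) • ((b, mk g) : ((ι →₀ ℚ) × P) × (G ⧸ L)) ∈ C at h
    change ((p : ℤ) ^ (j + 1)) • ((b, mk g) : ((ι →₀ ℚ) × P) × (G ⧸ L)) = 0
    rw [e] at h ⊢
    exact hC _ _ h (by rw [map_zsmul, hχ])
  -- The image of `⟨y⟩` in the third factor meets `S` trivially.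
  have hS : ∀ n : ℤ, ((0, mk (n • y)) : ((ι →₀ ℚ) × P) × (G ⧸ L)) ∈ S → n • y = 0 := by
    intro n hn
    by_contra h0
    have hne : ((0, mk (n • y)) : ((ι →₀ ℚ) × P) × (G ⧸ L)) ≠ 0 := fun h =>
      h0 (hLT _ ((hmk _).1 (congrArg Prod.snd h)) (hyT n))
    obtain ⟨m, ⟨g, hg⟩, hm0⟩ := hess _ hn hne
    have hg' : ((f g, χ g), mk (θ g)) =
        (((0, 0), mk ((m * n) • y)) : ((ι →₀ ℚ) × P) × (G ⧸ L)) := by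
      rw [← hφ, hg, mul_smul, map_zsmul mk m]
      exact Prod.ext (smul_zero m) rfl
    have h1 : f g = 0 := congrArg (fun z => z.1.1) hg'
    have h2 : χ g = 0 := congrArg (fun z => z.1.2) hg'
    have h3 : mk (θ g) = mk ((m * n) • y) := congrArg (fun z => z.2) hg'
    rw [hθN g (hχ0 g h2), ← sub_eq_zero, ← map_sub, hmk] at h3
    have h4 := sub_eq_zero.1 (hLT _ h3 (T.sub_mem (hTf g h1) (hyT _)))
    have h5 : g = 0 := by
      rw [h4]
      apply hinj
      rw [← map_zsmul, ← h4]
      exact hχ0 g h2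
    exact hm0 (by rw [← hg, h5, map_zero])
  -- Dividing `χ y` by the exponent of `C` in `P` and multiplying back removes the `C`-component, so
  -- `(0, χ y, 0)` lies in `S`.
  obtain ⟨v, hv⟩ := isDivisibleGroup_iff.1 hP _ (hpow (j + 1)) (χ y)
  obtain ⟨s, hs, c, hc, hsc⟩ := AddSubgroup.mem_sup.1
    (hSC.sup_eq_top ▸ AddSubgroup.mem_top (((0, v), 0) : ((ι →₀ ℚ) × P) × (G ⧸ L)))
  have h1 : (((0, χ y), 0) : ((ι →₀ ℚ) × P) × (G ⧸ L)) ∈ S := by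
    have : (((0, χ y), 0) : ((ι →₀ ℚ) × P) × (G ⧸ L)) = ((p : ℤ) ^ (j + 1)) • s := by
      rw [← add_zero (((p : ℤ) ^ (j + 1)) • s), ← hC' c hc, ← smul_add, hsc, ← hv]
      exact Prod.ext (Prod.ext (smul_zero _).symm rfl) (smul_zero _).symm
    rw [this]
    exact S.zsmul_mem hs _
  have h2 : φ y - ((0, χ y), 0) = ((0, mk ((p : ℤ) ^ j • y)) : ((ι →₀ ℚ) × P) × (G ⧸ L)) := by
    have hyf : f y = 0 := by simpa using hfT _ (hyT 1)
    have hyθ : θ y = (p : ℤ) ^ j • y := by simpa using hθy 1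
    rw [hφ, hyf, hyθ]
    simp
  have h3 := hS _ (h2 ▸ S.sub_mem (hφS ⟨y, rfl⟩) h1)
  exact hy' 0 (by rw [h3, smul_zero])

/-! ### Primary parts and the decomposition of the torsion subgroup. -/

/-- The `p`-primary part of an abelian group. -/
def pPrimary (G : Type*) [AddCommGroup G] (p : ℕ) : AddSubgroup G where
  carrier := {x | ∃ k : ℕ, ((p : ℤ) ^ k) • x = 0}
  zero_mem' := ⟨0, smul_zero _⟩
  add_mem' := by
    rintro x y ⟨k, hk⟩ ⟨l, hl⟩
    refine ⟨k + l, ?_⟩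
    rw [smul_add, pow_add, mul_smul _ _ y, hl, mul_comm, mul_smul, hk, smul_zero, smul_zero,
      add_zero]
  neg_mem' := by
    rintro x ⟨k, hk⟩
    exact ⟨k, by rw [smul_neg, hk, neg_zero]⟩

theorem mem_pPrimary {G : Type*} [AddCommGroup G] {p : ℕ} {x : G} :
    x ∈ pPrimary G p ↔ ∃ k : ℕ, ((p : ℤ) ^ k) • x = 0 := Iff.rfl

theorem mem_pPrimary_of_zsmul_mem {G : Type*} [AddCommGroup G] {p : ℕ} {x : G}
    (h : (p : ℤ) • x ∈ pPrimary G p) : x ∈ pPrimary G p := by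
  obtain ⟨k, hk⟩ := h
  exact ⟨k + 1, by rw [pow_succ, mul_smul, hk]⟩

/-- The subgroup `p T_p`, where `T_p` is the `p`-primary part. -/
def pMulPrimary (G : Type*) [AddCommGroup G] (p : ℕ) : AddSubgroup G :=
  (pPrimary G p).map (zsmulAddGroupHom (p : ℤ))

theorem mem_pMulPrimary {G : Type*} [AddCommGroup G] {p : ℕ} {x : G} :
    x ∈ pMulPrimary G p ↔ ∃ y ∈ pPrimary G p, (p : ℤ) • y = x := Iff.rfl

theorem pMulPrimary_le {G : Type*} [AddCommGroup G] {p : ℕ} : pMulPrimary G p ≤ pPrimary G p := by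
  rintro _ ⟨y, hy, rfl⟩
  exact (pPrimary G p).zsmul_mem hy _

theorem isDivisibleGroup_subgroup_iff {G : Type*} [AddCommGroup G] {H : AddSubgroup G} :
    IsDivisibleGroup H ↔ ∀ n : ℤ, n ≠ 0 → ∀ x ∈ H, ∃ y ∈ H, n • y = x := by
  rw [isDivisibleGroup_iff]
  constructor
  · intro h n hn x hx
    obtain ⟨y, hy⟩ := h n hn ⟨x, hx⟩
    exact ⟨y, y.2, congrArg Subtype.val hy⟩
  · rintro h n hn ⟨x, hx⟩
    obtain ⟨y, hy, hyx⟩ := h n hn x hx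
    exact ⟨⟨y, hy⟩, Subtype.ext hyx⟩

theorem Int.exists_eq_prime_pow_mul_isCoprime {p : ℕ} (hp : p.Prime) {n : ℤ} (hn : n ≠ 0) :
    ∃ (a : ℕ) (c : ℤ), n = (p : ℤ) ^ a * c ∧ IsCoprime (p : ℤ) c := by
  have hp' := Nat.prime_iff_prime_int.1 hp
  obtain ⟨c, hc, hpc⟩ :=
    (FiniteMultiplicity.of_not_isUnit hp'.not_isUnit hn).exists_eq_pow_mul_and_not_dvd
  exact ⟨_, c, hc, hp'.coprime_iff_not_dvd.2 hpc⟩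

/-- The hypothesis gives divisibility by `p`; integers prime to `p` act invertibly on elements of
`p`-power order. -/
theorem isDivisibleGroup_pMulPrimary {G : Type*} [AddCommGroup G] {p : ℕ} (hp : p.Prime)
    (h : ∀ x ∈ pPrimary G p, ∃ w : G, (p : ℤ) • (p : ℤ) • w = (p : ℤ) • x) :
    IsDivisibleGroup (pMulPrimary G p) := by
  rw [isDivisibleGroup_subgroup_iff]
  have hstep : ∀ x ∈ pMulPrimary G p, ∃ y ∈ pMulPrimary G p, (p : ℤ) • y = x := by
    rintro _ ⟨x, hx, rfl⟩
    obtain ⟨w, hw⟩ := h x hx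
    refine ⟨(p : ℤ) • w, ⟨w, ?_, rfl⟩, hw⟩
    refine mem_pPrimary_of_zsmul_mem (mem_pPrimary_of_zsmul_mem ?_)
    rw [hw]
    exact (pPrimary G p).zsmul_mem hx _
  have hpow : ∀ a : ℕ, ∀ x ∈ pMulPrimary G p, ∃ y ∈ pMulPrimary G p, ((p : ℤ) ^ a) • y = x := by
    intro a
    induction a with
    | zero => exact fun x hx => ⟨x, hx, by simp⟩
    | succ a ih =>
      intro x hx
      obtain ⟨y, hy, rfl⟩ := hstep x hx
      obtain ⟨z, hz, rfl⟩ := ih y hy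
      exact ⟨z, hz, by rw [pow_succ', mul_smul]⟩
  intro n hn x hx
  obtain ⟨a, c, rfl, hc⟩ := Int.exists_eq_prime_pow_mul_isCoprime hp hn
  obtain ⟨y, hy, rfl⟩ := hpow a x hx
  obtain ⟨k, hk⟩ := pMulPrimary_le hy
  obtain ⟨s, t, hst⟩ := hc.pow_left (m := k)
  refine ⟨t • y, (pMulPrimary G p).zsmul_mem hy _, ?_⟩
  have : (c * t) • y = y := by
    calc (c * t) • y = (s * (p : ℤ) ^ k + t * c) • y := by
          rw [add_smul, mul_smul s, hk, smul_zero, zero_add, mul_comm]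
      _ = y := by rw [hst, one_smul]
  rw [mul_smul, ← mul_smul c, this]

theorem isDivisibleGroup_iSup {G : Type*} [AddCommGroup G] {ι : Type*} {D : ι → AddSubgroup G}
    (h : ∀ i, IsDivisibleGroup (D i)) : IsDivisibleGroup (⨆ i, D i : AddSubgroup G) := by
  simp only [isDivisibleGroup_subgroup_iff] at h ⊢
  intro n hn x hx
  have hle : (⨆ i, D i) ≤ (⨆ i, D i).map (zsmulAddGroupHom n) := by
    refine iSup_le fun i z hz => ?_
    obtain ⟨y, hy, hyz⟩ := h i n hn z hz
    exact ⟨y, (le_iSup D i) hy, hyz⟩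
  obtain ⟨y, hy, hyx⟩ := hle hx
  exact ⟨y, hy, hyx⟩

/-- A divisible subgroup is the image of a retraction. -/
theorem exists_retraction_of_isDivisibleGroup {G : Type*} [AddCommGroup G] {D : AddSubgroup G}
    (hD : IsDivisibleGroup D) : ∃ d : G →+ G, (∀ g, d g ∈ D) ∧ ∀ x ∈ D, d x = x := by
  obtain ⟨h, hh⟩ := hD.exists_extension D (AddMonoidHom.id D)
  exact ⟨D.subtype.comp h, fun g => (h g).2, fun x hx => congrArg Subtype.val (hh ⟨x, hx⟩)⟩

/-- The sum `D` of all `p T_p` is divisible, hence splits off. If `p * p * m` is the order of `x` in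
the complement, then `(p * m) • x` lies in `p T_p ≤ D`, so it vanishes, which is absurd. -/
theorem isDPlusE_of_divisible_pMulPrimary {T : Type u} [AddCommGroup T]
    (hT : ∀ x : T, ∃ n : ℤ, n ≠ 0 ∧ n • x = 0)
    (h : ∀ p : ℕ, p.Prime → IsDivisibleGroup (pMulPrimary T p)) : IsDPlusE T := by
  let D : AddSubgroup T := ⨆ p : Nat.Primes, pMulPrimary T p
  have hD : IsDivisibleGroup D := isDivisibleGroup_iSup fun p : Nat.Primes => h p p.2
  obtain ⟨d, hdD, hd⟩ := exists_retraction_of_isDivisibleGroup hD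
  refine ⟨D, d.ker, inferInstance, inferInstance, hD, ?_, ⟨?_⟩⟩
  · rintro ⟨x, hx⟩
    rw [AddSubgroup.addOrderOf_mk, Nat.squarefree_iff_prime_squarefree]
    rintro p hp ⟨m, hm⟩
    have hpos : 0 < addOrderOf x :=
      (isOfFinAddOrder_iff_zsmul_eq_zero.2 (hT x)).addOrderOf_pos
    have hpD : (p : ℤ) • (m : ℤ) • x ∈ D := by
      refine (le_iSup (fun p : Nat.Primes => pMulPrimary T p) ⟨p, hp⟩) ⟨_, ⟨2, ?_⟩, rfl⟩
      rw [← mul_smul, ← addOrderOf_dvd_iff_zsmul_eq_zero, hm]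
      exact ⟨1, by push_cast; ring⟩
    have h0 : (p : ℤ) • (m : ℤ) • x = 0 := by
      rw [← hd _ hpD, map_zsmul, map_zsmul, (hx : d x = 0), smul_zero, smul_zero]
    rw [← mul_smul, ← addOrderOf_dvd_iff_zsmul_eq_zero] at h0
    have hdvd : addOrderOf x ∣ p * m := by exact_mod_cast h0
    have hpm : 0 < p * m := by
      rw [hm, mul_assoc] at hpos
      exact pos_of_mul_pos_right hpos (Nat.zero_le _)
    have hle := Nat.le_of_dvd hpm hdvd
    rw [hm, mul_assoc] at hle
    nlinarith [hp.two_le]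
  · exact
      { toFun := fun t => (⟨d t, hdD t⟩, ⟨t - d t, by
          rw [AddMonoidHom.mem_ker, map_sub, hd _ (hdD t), sub_self]⟩)
        invFun := fun z => z.1 + z.2
        left_inv := fun t => by simp
        right_inv := by
          rintro ⟨⟨x, hx⟩, ⟨e, he⟩⟩
          have he' : d e = 0 := he
          simp [map_add, hd x hx, he']
        map_add' := fun s t => by
          refine Prod.ext (Subtype.ext ?_) (Subtype.ext ?_)
          · exact map_add d s t
          · change s + t - d (s + t) = (s - d s) + (t - d t)
            rw [map_add]
            abel }

/-- If `p ^ j • y ∈ p ^ (j + 1) G` for all `j ≥ 1` and all `y` with `p ^ (j + 1) • y = 0`, then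
`p T_p` is `p`-divisible. -/
theorem exists_zsmul_zsmul_eq_of_pPrimary {G : Type*} [AddCommGroup G] {p : ℕ}
    (h : ∀ j : ℕ, 1 ≤ j → ∀ y : G, ((p : ℤ) ^ (j + 1)) • y = 0 →
      ∃ g : G, ((p : ℤ) ^ (j + 1)) • g = ((p : ℤ) ^ j) • y) :
    ∀ x ∈ pPrimary G p, ∃ w : G, (p : ℤ) • (p : ℤ) • w = (p : ℤ) • x := by
  rintro x ⟨k, hk⟩
  induction k generalizing x with
  | zero => exact ⟨0, by rw [show x = 0 by simpa using hk]; simp⟩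
  | succ k ih =>
    rcases Nat.eq_zero_or_pos k with rfl | hk0
    · exact ⟨0, by rw [show (p : ℤ) • x = 0 by simpa using hk]; simp⟩
    · obtain ⟨g, hg⟩ := h k hk0 x hk
      -- Subtracting `p • g` lowers the exponent from `k + 1` to `k`.
      obtain ⟨w, hw⟩ := ih (x - (p : ℤ) • g) (by
        rw [smul_sub, ← mul_smul, ← pow_succ, hg, sub_self])
      refine ⟨g + w, ?_⟩
      rw [smul_add, smul_add, hw, smul_sub]
      abel

theorem isDivisibleGroup_of_prime {A : Type*} [AddCommGroup A]
    (h : ∀ p : ℕ, p.Prime → ∀ x : A, ∃ y, (p : ℤ) • y = x) : IsDivisibleGroup A := by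
  have hnat : ∀ n : ℕ, n ≠ 0 → ∀ x : A, ∃ y, (n : ℤ) • y = x := by
    intro n
    induction n using induction_on_primes with
    | zero => exact fun h => absurd rfl h
    | one => exact fun _ x => ⟨x, by simp⟩
    | prime_mul p a hp ih =>
      intro hpa x
      obtain ⟨y, rfl⟩ := h p hp x
      obtain ⟨z, rfl⟩ := ih (right_ne_zero_of_mul hpa) y
      exact ⟨z, by push_cast; rw [mul_smul]⟩
  rw [isDivisibleGroup_iff]
  intro n hn x
  obtain ⟨y, hy⟩ := hnat n.natAbs (Int.natAbs_ne_zero.2 hn) x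
  rcases Int.natAbs_eq n with hn' | hn'
  · exact ⟨y, by rw [hn', hy]⟩
  · exact ⟨-y, by rw [hn', neg_smul_neg, hy]⟩

/-! ### Splitting off `T_p` and divisibility of `G/T`. -/

/-- If `p T_p` is divisible, the `p`-primary part `T_p` is a direct summand. -/
theorem exists_complement_pPrimary {G : Type*} [AddCommGroup G] {p : ℕ} (hp : p.Prime)
    (hD : IsDivisibleGroup (pMulPrimary G p)) :
    ∃ M : AddSubgroup G, (∀ x ∈ M, x ∈ pPrimary G p → x = 0) ∧
      ∀ g, ∃ t ∈ pPrimary G p, ∃ m ∈ M, g = t + m := by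
  obtain ⟨d, hdD, hd⟩ := exists_retraction_of_isDivisibleGroup hD
  obtain ⟨M, hBM, -, hM, hMmax⟩ := AddSubgroup.exists_maximal_disjoint
    (d.ker.map (zsmulAddGroupHom (p : ℤ))) ⊤ (pPrimary G p) le_top (by
      rintro _ ⟨g, hg, rfl⟩ hgp
      have hg0 : d g = 0 := hg
      have hgp' : (p : ℤ) • g ∈ pPrimary G p := hgp
      have h1 := hd _ (mem_pMulPrimary.2 ⟨g, mem_pPrimary_of_zsmul_mem hgp', rfl⟩)
      change (p : ℤ) • g = 0
      rw [← h1, map_zsmul, hg0, smul_zero])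
  refine ⟨M, hM, fun g => ?_⟩
  have hker : ∀ g, d g = 0 → ∃ t ∈ pPrimary G p, ∃ m ∈ M, g = t + m := by
    intro g hg
    by_cases hgM : g ∈ M
    · exact ⟨0, AddSubgroup.zero_mem _, g, hgM, (zero_add g).symm⟩
    have hpg : (p : ℤ) • g ∈ M := hBM ⟨g, hg, rfl⟩
    obtain ⟨n, m, hm, ht, ht0⟩ := hMmax g trivial hgM
    -- As `p • g ∈ M`, a coefficient divisible by `p` would put `m + n • g` in `M`. So `n` is prime
    -- to `p`, and a Bézout relation expresses `g`.
    have hpn : ¬ (p : ℤ) ∣ n := by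
      rintro ⟨a, rfl⟩
      refine ht0 (hM _ (M.add_mem hm ?_) ht)
      rw [mul_comm, mul_smul]
      exact M.zsmul_mem hpg a
    obtain ⟨a, b, hab⟩ := (Nat.prime_iff_prime_int.1 hp).coprime_iff_not_dvd.2 hpn
    refine ⟨b • (m + n • g), AddSubgroup.zsmul_mem _ ht b, a • (p : ℤ) • g - b • m,
      M.sub_mem (M.zsmul_mem hpg a) (M.zsmul_mem hm b), ?_⟩
    calc g = (a * p + b * n) • g := by rw [hab, one_smul]
      _ = _ := by module
  obtain ⟨t, ht, m, hm, htm⟩ := hker (g - d g) (by rw [map_sub, hd _ (hdD g), sub_self])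
  refine ⟨d g + t, AddSubgroup.add_mem _ (pMulPrimary_le (hdD g)) ht, m, hm, ?_⟩
  rw [add_assoc, ← htm, add_sub_cancel]

/-- If `p T_p` is divisible, then `G = p G + T`. -/
theorem IsSemiGeneralizedCoBassian.exists_eq_zsmul_add_torsion {G : Type u} [AddCommGroup G]
    (hG : IsSemiGeneralizedCoBassian G) (hrank : Cardinal.aleph0 ≤ Module.rank ℤ G)
    {p : ℕ} (hp : p.Prime) (hD : IsDivisibleGroup (pMulPrimary G p)) (g : G) :
    ∃ t ∈ AddCommGroup.torsion G, ∃ h : G, g = (p : ℤ) • h + t := by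
  have hpZ : (p : ℤ) ≠ 0 := by exact_mod_cast hp.ne_zero
  obtain ⟨M, hM, hMG⟩ := exists_complement_pPrimary hp hD
  let R : AddSubgroup G := (zsmulAddGroupHom (p : ℤ) : G →+ G).range
  have hR : ∀ x ∈ R, ∃ h : G, (p : ℤ) • h = x := fun x hx => hx
  obtain ⟨ι, F, f, w, hFN, hF, hfF, -, hw⟩ := exists_free_subgroup hrank (M ⊓ R)
    (fun g => by
      obtain ⟨t, ⟨k, hk⟩, m, hm, rfl⟩ := hMG g
      refine ⟨(p : ℤ) ^ (k + 1), pow_ne_zero _ hpZ, ?_, ⟨((p : ℤ) ^ k) • (t + m), ?_⟩⟩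
      · rw [smul_add, pow_succ', mul_smul _ _ t, hk, smul_zero, zero_add]
        exact M.zsmul_mem hm _
      · rw [pow_succ', mul_smul]
        rfl) ℚ isDivisibleGroup_rat
  let T := AddCommGroup.torsion G
  have hTf : ∀ x, f x = 0 → x ∈ T := fun x hx => mem_torsion_of_map_eq_zero hF hfF hx
  have hFT : ∀ x ∈ F, x ∈ T → x = 0 := fun x hx hxT =>
    hfF x hx (map_eq_zero_of_mem_torsion f hxT)
  let mk : G →+ G ⧸ F := QuotientAddGroup.mk' F
  have hmk : ∀ g, mk g = 0 ↔ g ∈ F := fun g => QuotientAddGroup.eq_zero_iff g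
  let q : G →+ (ι →₀ ℚ) × (G ⧸ F) := ((AddMonoidHom.fst _ _).comp w).prod mk
  let φ : G →+ (ι →₀ ℚ) × (G ⧸ F) := f.prod mk
  have hφ : ∀ g, φ g = (f g, mk g) := fun g => rfl
  have hq : Function.Surjective q := by
    rintro ⟨x, gL⟩
    obtain ⟨g, rfl⟩ := QuotientAddGroup.mk'_surjective F gL
    obtain ⟨l, hl, hlx⟩ := hw ((x, 0) - w g)
    refine ⟨g + l, Prod.ext ?_ ?_⟩
    · change (w (g + l)).1 = x
      rw [map_add, hlx, add_sub_cancel]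
    · change mk (g + l) = mk g
      rw [map_add, (hmk l).2 hl, add_zero]
  have hφinj : Function.Injective φ := by
    rw [injective_iff_map_eq_zero]
    intro g hg
    have h1 : f g = 0 := congrArg (fun z => z.1) hg
    have h2 : mk g = 0 := congrArg (fun z => z.2) hg
    exact hfF g ((hmk g).1 h2) h1
  obtain ⟨S, C, hSC, hφS, hess⟩ := hG.exists_summand q hq φ hφinj
  have hdisj : ∀ x ∈ S, x ∈ C → x = 0 := fun x hx hx' =>
    AddSubgroup.disjoint_def.1 hSC.disjoint hx hx'
  have hsum : ∀ x, ∃ s ∈ S, ∃ c ∈ C, s + c = x := fun x =>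
    AddSubgroup.mem_sup.1 (hSC.sup_eq_top ▸ AddSubgroup.mem_top x)
  -- An element `(b, mk g)` of `C` is `φ g` plus a `p`-multiple of `(v, 0)`. Projecting to `C` kills
  -- `φ g` and leaves `p` times the projection of `(v, 0)`.
  have hC : ∀ c ∈ C, ∃ c' ∈ C, (p : ℤ) • c' = c := by
    rintro ⟨b, gL⟩ hc
    obtain ⟨g, rfl⟩ := QuotientAddGroup.mk'_surjective F gL
    obtain ⟨v, hv⟩ := isDivisibleGroup_iff.1 (isDivisibleGroup_finsupp_rat ι) _ hpZ (b - f g)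
    obtain ⟨s, hs, c', hc', hsc⟩ := hsum (v, 0)
    refine ⟨c', hc', ?_⟩
    have h1 : ((b, mk g) : (ι →₀ ℚ) × (G ⧸ F)) = φ g + (p : ℤ) • (v, 0) := by
      rw [hφ]
      refine Prod.ext ?_ ?_
      · change b = f g + (p : ℤ) • v
        rw [hv, add_sub_cancel]
      · change mk g = mk g + (p : ℤ) • 0
        rw [smul_zero, add_zero]
    have h2 : ((b, mk g) : (ι →₀ ℚ) × (G ⧸ F)) - (p : ℤ) • c' = φ g + (p : ℤ) • s := by
      rw [h1, ← hsc]
      module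
    refine (sub_eq_zero.1 (hdisj _ ?_ (C.sub_mem hc (C.zsmul_mem hc' _)))).symm
    change ((b, mk g) : (ι →₀ ℚ) × (G ⧸ F)) - (p : ℤ) • c' ∈ S
    rw [h2]
    exact S.add_mem (hφS ⟨g, rfl⟩) (S.zsmul_mem hs _)
  have hS' : ∀ h : G, ((0, mk h) : (ι →₀ ℚ) × (G ⧸ F)) ∈ S → ∀ a : ℕ, (p : ℤ) ^ a • h ∈ F →
      ∃ t ∈ T, ∃ h' : G, h = (p : ℤ) • h' + t := by
    intro h hhS a ha
    obtain ⟨t, ⟨k, hk⟩, m, hm, rfl⟩ := hMG h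
    have htT : t ∈ T := mem_torsion_iff_zsmul.2 ⟨_, pow_ne_zero k hpZ, hk⟩
    have hmS : ((0, mk m) : (ι →₀ ℚ) × (G ⧸ F)) ∈ S := by
      have := S.sub_mem hhS (hφS ⟨t, rfl⟩)
      rw [hφ, map_eq_zero_of_mem_torsion f htT] at this
      simpa using this
    -- Otherwise some nonzero `φ x` is a multiple of `(0, mk m)`. Then `x` is torsion in `M`, and a
    -- `p`-power carries it into `F`, which is torsion-free, so `x` lies in `M ∩ T_p = 0`.
    have hmF : m ∈ F := by
      by_contra hmF
      obtain ⟨n, ⟨x, hx⟩, hn0⟩ := hess _ hmS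
        (fun h0 => hmF ((hmk m).1 (congrArg Prod.snd h0)))
      have hx' : ((f x, mk x) : (ι →₀ ℚ) × (G ⧸ F)) = (n • 0, n • mk m) := hx
      have h1 : f x = 0 := (congrArg Prod.fst hx').trans (smul_zero n)
      have h2 : x - n • m ∈ F := by
        rw [← hmk, map_sub, map_zsmul, sub_eq_zero]
        exact congrArg Prod.snd hx'
      have hxM : x ∈ M := by
        simpa using M.add_mem (hFN h2).1 (M.zsmul_mem hm n)
      have hm' : (p : ℤ) ^ (a + k) • m ∈ F := by
        have := F.zsmul_mem ha ((p : ℤ) ^ k)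
        rwa [smul_add, smul_add, smul_comm, hk, smul_zero, zero_add, ← mul_smul, ← pow_add,
          add_comm k] at this
      have hxF : (p : ℤ) ^ (a + k) • x ∈ F := by
        have := F.add_mem (F.zsmul_mem h2 ((p : ℤ) ^ (a + k))) (F.zsmul_mem hm' n)
        rwa [smul_sub, smul_comm n, sub_add_cancel] at this
      have hx0 : x = 0 := hM x hxM ⟨a + k, hFT _ hxF (T.zsmul_mem (hTf x h1) _)⟩
      exact hn0 (by rw [← hx, hx0, map_zero])
    obtain ⟨h', rfl⟩ := hR m (hFN hmF).2
    exact ⟨t, htT, h', add_comm _ _⟩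
  -- The part `c` of the order prime to `p` is removed by Bézout: `h` is `v • c • h` plus a
  -- `p`-multiple.
  have hS : ∀ h : G, ((0, mk h) : (ι →₀ ℚ) × (G ⧸ F)) ∈ S →
      ∃ t ∈ T, ∃ h' : G, h = (p : ℤ) • h' + t := by
    intro h hh
    obtain ⟨n, hn, hnF⟩ := hF h
    obtain ⟨a, c, rfl, hc⟩ := Int.exists_eq_prime_pow_mul_isCoprime hp hn
    obtain ⟨t, ht, h', hh'⟩ := hS' (c • h) (by
      have := S.zsmul_mem hh c
      rw [map_zsmul]
      simpa using this) a (by rwa [← mul_smul])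
    obtain ⟨u, v, huv⟩ := hc
    refine ⟨v • t, T.zsmul_mem ht v, u • h + v • h', ?_⟩
    calc h = (u * p + v * c) • h := by rw [huv, one_smul]
      _ = (u * p) • h + v • c • h := by module
      _ = _ := by rw [hh']; module
  obtain ⟨⟨b, hL⟩, hs, c, hc, hsc⟩ := hsum (0, mk g)
  obtain ⟨h, rfl⟩ := QuotientAddGroup.mk'_surjective F hL
  have hs' : ((b, mk h) : (ι →₀ ℚ) × (G ⧸ F)) ∈ S := hs
  have hsc' : ((b, mk h) : (ι →₀ ℚ) × (G ⧸ F)) + c = (0, mk g) := hsc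
  -- `(0, mk g)` is torsion because `G ⧸ F` is, so its `S`-component is torsion too, and `ι →₀ ℚ` is
  -- torsion-free.
  have hb : b = 0 := by
    obtain ⟨n, hn, hnF⟩ := hF g
    have h1 : n • ((b, mk h) : (ι →₀ ℚ) × (G ⧸ F)) = -(n • c) := by
      rw [← add_eq_zero_iff_eq_neg, ← smul_add, hsc']
      refine Prod.ext (smul_zero n) ?_
      change n • mk g = 0
      rw [← map_zsmul, hmk]
      exact hnF
    have h2 : n • b = 0 := congrArg Prod.fst (hdisj _ (S.zsmul_mem hs' n)
      (h1 ▸ C.neg_mem (C.zsmul_mem hc n)))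
    rw [← Int.cast_smul_eq_zsmul ℚ] at h2
    exact (smul_eq_zero.1 h2).resolve_left (by exact_mod_cast hn)
  subst hb
  obtain ⟨⟨b₁, hL₁⟩, -, rfl⟩ := hC c hc
  obtain ⟨h₁, rfl⟩ := QuotientAddGroup.mk'_surjective F hL₁
  have h3 : mk h + (p : ℤ) • mk h₁ = mk g := congrArg Prod.snd hsc'
  rw [← map_zsmul, ← map_add, ← sub_eq_zero, ← map_sub, hmk] at h3
  obtain ⟨x, hx⟩ := hR _ (hFN h3).2
  obtain ⟨t, ht, h', rfl⟩ := hS h hs'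
  refine ⟨t, ht, h' + h₁ - x, ?_⟩
  rw [smul_sub, hx]
  module

theorem proposition2 {G : Type*} [AddCommGroup G]
    (hG : IsSemiGeneralizedCoBassian G) (hrank : Cardinal.aleph0 ≤ Module.rank ℤ G) :
    IsDivisibleGroup (G ⧸ AddCommGroup.torsion G) ∧ IsDPlusE (AddCommGroup.torsion G) := by
  have hprim : ∀ p : ℕ, p.Prime →
      ∀ x ∈ pPrimary G p, ∃ w : G, (p : ℤ) • (p : ℤ) • w = (p : ℤ) • x := fun p hp =>
    exists_zsmul_zsmul_eq_of_pPrimary fun j hj y hy => hG.exists_pow_zsmul_eq hrank hp hj hy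
  constructor
  · refine isDivisibleGroup_of_prime fun p hp x => ?_
    obtain ⟨g, rfl⟩ := QuotientAddGroup.mk'_surjective _ x
    obtain ⟨t, ht, h, rfl⟩ := hG.exists_eq_zsmul_add_torsion hrank hp
      (isDivisibleGroup_pMulPrimary hp (hprim p hp)) g
    refine ⟨QuotientAddGroup.mk' _ h, ?_⟩
    have ht' : QuotientAddGroup.mk' (AddCommGroup.torsion G) t = 0 :=
      (QuotientAddGroup.eq_zero_iff t).2 ht
    rw [map_add, map_zsmul, ht', add_zero]
  · refine isDPlusE_of_divisible_pMulPrimary (fun x => ?_) fun p hp =>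
      isDivisibleGroup_pMulPrimary hp ?_
    · obtain ⟨n, hn, hx⟩ := mem_torsion_iff_zsmul.1 x.2
      exact ⟨n, hn, Subtype.ext hx⟩
    · rintro x ⟨k, hk⟩
      obtain ⟨w, hw⟩ := hprim p hp x ⟨k, congrArg Subtype.val hk⟩
      have hpZ : (p : ℤ) ≠ 0 := by exact_mod_cast hp.ne_zero
      have hwT : w ∈ AddCommGroup.torsion G := by
        refine mem_torsion_iff_zsmul.2 ⟨(p : ℤ) ^ k * (p * p),
          mul_ne_zero (pow_ne_zero k hpZ) (mul_ne_zero hpZ hpZ), ?_⟩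
        rw [mul_smul, mul_smul, hw, smul_comm]
        have : (p : ℤ) ^ k • (x : G) = 0 := congrArg Subtype.val hk
        rw [this, smul_zero]
      exact ⟨⟨w, hwT⟩, Subtype.ext hw⟩
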